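/- Let $d\ge 1$ be an integer. Call a non-negative Borel measure $\mu$ on $\mathbb R^d$ admissible if it has moments of all orders, i.e. every monomial $\mathbf x^\alpha=x_1^{\alpha_1}\cdots x_d^{\alpha_d}$, $\alpha\in\mathbb N_0^d$, is $\mu$-integrable, and let $s_\alpha(\mu)=\int \mathbf x^\alpha\,d\mu(\mathbf x)$. Let $\mathcal M([-1,1]^d)$ be the set of all moment families $(s_\alpha(\mu))_{\alpha\in\mathbb N_0^d}$ of admissible measures $\mu$ supported on $[-1,1]^d$. A function $F:\mathbb R\to\mathbb R$, applied entrywise, maps $\mathcal M([-1,1]^d)$ into itself (that is, $(F(s_\alpha))_{\alpha\in\mathbb N_0^d}\in\mathcal M([-1,1]^d)$ for every $(s_\alpha)_{\alpha\in\mathbb N_0^d}\in\mathcal M([-1,1]^d)$) if and only if $F$ is the restriction to $\mathbb R$ of an absolutely monotonic entire function, i.e. of an entire function $G:\mathbb C\to\mathbb C$ whose Taylor coefficients at every point of $(0,\infty)$ are non-negative real numbers. -/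

import Mathlib

open MeasureTheory

namespace MomentTransform

/-- The monomial `x ^ α = x₁ ^ α₁ ⋯ x_d ^ α_d` on `ℝ^d`. -/
def monom {d : ℕ} (α : Fin d → ℕ) (x : Fin d → ℝ) : ℝ :=
  ∏ i, x i ^ α i

/-- A non-negative Borel measure on `ℝ^d` is admissible if it has moments of all orders. -/
def Admissible {d : ℕ} (μ : Measure (Fin d → ℝ)) : Prop :=
  ∀ α : Fin d → ℕ, Integrable (monom α) μ

/-- The moment family `s_α(μ) = ∫ x ^ α dμ(x)`, indexed by all multi-indices `α`. -/
noncomputable def momentFamily {d : ℕ} (μ : Measure (Fin d → ℝ)) : (Fin d → ℕ) → ℝ :=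
  fun α => ∫ x, monom α x ∂μ

/-- The set of all moment families of admissible measures supported on `K ⊆ ℝ^d`. -/
def momentSet {d : ℕ} (K : Set (Fin d → ℝ)) : Set ((Fin d → ℕ) → ℝ) :=
  {s | ∃ μ : Measure (Fin d → ℝ), Admissible μ ∧ μ Kᶜ = 0 ∧ momentFamily μ = s}

/-- The cube `[-1, 1]^d`. -/
def cube (d : ℕ) : Set (Fin d → ℝ) :=
  {x | ∀ i, x i ∈ Set.Icc (-1 : ℝ) 1}

/-- An absolutely monotonic entire function: an entire function whose Taylor coefficients at
every point of `(0, ∞)` are non-negative real numbers. -/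
def AbsMonotonicEntire (G : ℂ → ℂ) : Prop :=
  Differentiable ℂ G ∧
    ∀ x : ℝ, 0 < x → ∀ n : ℕ,
      ∃ c : ℝ, 0 ≤ c ∧ iteratedDeriv n G (x : ℂ) / (n.factorial : ℂ) = (c : ℂ)

end MomentTransform

namespace MomentTransform

open Filter Topology Set
open scoped ContDiff Nat Polynomial Convolution

/-! Both conditions are equivalent to `F` being an everywhere convergent power series `∑ c_k x ^ k`
with `c_k ≥ 0`. Sufficiency: monomials are multiplicative, so the `k`-fold multiplicative
convolution of `μ` has moments `s_α ^ k`, and `∑ c_k μ^{*k}` represents `F(s_α)`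
(`comp_mem_momentSet_of_hasSum`). Necessity: two atoms on a coordinate line show that `F(a + b u ^
n)` is a moment sequence on `[-1, 1]` for `a, b ≥ 0` and `|u| ≤ 1` (`isIntervalMoment_two_atoms`).
With `u = 1/2`, pairing with a polynomial that vanishes at `2⁻ᵏ` for `k < m` isolates the `m`-th
derivative and makes it nonnegative, once `F` is smooth. In general `F` is mollified, Bernstein's
theorem expands each mollification, and a compactness argument on the coefficients gives the series
on `(0, ∞)`. A negative `u` then places any `x ≤ 0` as the first moment of a sequence whose other
terms come from positive arguments, and those determine the first moment
(`IsIntervalMoment.one_eq`). -/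

/-! ### Nonnegative derivatives from positivity against polynomials. -/

/-- By Taylor's formula `ψ b / b ^ m` tends to `ψ⁽ᵐ⁾(0) / m!` as `b → 0⁺`. -/
theorem iteratedDeriv_nonneg_of_vanishing {ψ : ℝ → ℝ} (hψ : ContDiff ℝ ∞ ψ) (m : ℕ)
    (h0 : ∀ k < m, iteratedDeriv k ψ 0 = 0) (hpos : ∀ b, 0 < b → 0 ≤ ψ b) :
    0 ≤ iteratedDeriv m ψ 0 := by
  have ht := Real.taylor_tendsto (n := m) convex_univ (mem_univ (0 : ℝ))
    (hψ.of_le (by exact_mod_cast le_top)).contDiffOn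
  rw [nhdsWithin_univ] at ht
  have ht' := (ht.mono_left (nhdsWithin_le_nhds (s := Ioi 0))).add_const
    ((m ! : ℝ)⁻¹ * iteratedDeriv m ψ 0)
  rw [zero_add] at ht'
  have hlim : 0 ≤ (m ! : ℝ)⁻¹ * iteratedDeriv m ψ 0 := by
    refine ge_of_tendsto ht' ?_
    filter_upwards [self_mem_nhdsWithin] with b hb
    have hb : 0 < b := hb
    have hT : taylorWithinEval ψ m univ 0 b = (m ! : ℝ)⁻¹ * b ^ m * iteratedDeriv m ψ 0 := by
      rw [taylor_within_apply, Finset.sum_range_succ, Finset.sum_eq_zero]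
      · simp [iteratedDerivWithin_univ]
      · intro k hk
        simp [iteratedDerivWithin_univ, h0 k (Finset.mem_range.1 hk)]
    rw [hT, sub_zero, sub_div]
    have h1 : (m ! : ℝ)⁻¹ * b ^ m * iteratedDeriv m ψ 0 / b ^ m
        = (m ! : ℝ)⁻¹ * iteratedDeriv m ψ 0 := by
      field_simp
    rw [h1, sub_add_cancel]
    exact div_nonneg (hpos b hb) (by positivity)
  exact nonneg_of_mul_nonneg_right hlim (by positivity)

/-- A smooth function whose values along `a + b 2⁻ⁿ` are positive against all polynomials that are
nonnegative on `[-1, 1]` has nonnegative derivatives at `a`. -/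
theorem iteratedDeriv_nonneg_of_polynomial {f : ℝ → ℝ} (hf : ContDiff ℝ ∞ f) (a : ℝ)
    (h : ∀ b, 0 < b → ∀ p : ℝ[X], (∀ x ∈ Icc (-1 : ℝ) 1, 0 ≤ p.eval x) →
      0 ≤ ∑ n ∈ p.support, p.coeff n * f (a + b * (1 / 2) ^ n)) (m : ℕ) :
    0 ≤ iteratedDeriv m f a := by
  -- The squares make `p` nonnegative. The `k`-th derivative at `b = 0` of `∑ pₙ f(a + b 2⁻ⁿ)` is
  -- `p(2⁻ᵏ) f⁽ᵏ⁾(a)`, so the roots kill all orders below `m`, while `p(2⁻ᵐ) > 0`.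
  set p : ℝ[X] := ∏ k ∈ Finset.range m, (Polynomial.X - Polynomial.C ((1 / 2 : ℝ) ^ k)) ^ 2
    with hp
  have hpe : ∀ x, p.eval x = ∏ k ∈ Finset.range m, (x - (1 / 2 : ℝ) ^ k) ^ 2 := by
    intro x
    simp [hp, Polynomial.eval_prod]
  set ψ : ℝ → ℝ := fun b => ∑ n ∈ p.support, p.coeff n * f (a + b * (1 / 2) ^ n) with hψ
  have hterm : ∀ n : ℕ, ContDiff ℝ ∞ (fun b => p.coeff n * f (a + b * (1 / 2) ^ n)) := by
    intro n
    exact contDiff_const.mul (hf.comp (by fun_prop))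
  have hsm : ContDiff ℝ ∞ ψ := ContDiff.sum fun n _ => hterm n
  have hder : ∀ k, iteratedDeriv k ψ 0 = p.eval ((1 / 2) ^ k) * iteratedDeriv k f a := by
    intro k
    have h1 : iteratedDeriv k ψ 0 = ∑ n ∈ p.support,
        iteratedDeriv k (fun b => p.coeff n * f (a + b * (1 / 2) ^ n)) 0 :=
      iteratedDeriv_fun_sum fun n _ => ((hterm n).of_le (by exact_mod_cast le_top)).contDiffAt
    rw [h1, Polynomial.eval_eq_sum, Polynomial.sum, Finset.sum_mul]
    refine Finset.sum_congr rfl fun n _ => ?_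
    have hg : ContDiff ℝ k (fun y => f (a + y)) :=
      (hf.of_le (by exact_mod_cast le_top)).comp (by fun_prop)
    have h2 := congrFun (iteratedDeriv_comp_const_mul hg ((1 / 2 : ℝ) ^ n)) 0
    rw [iteratedDeriv_comp_const_add] at h2
    simp only [mul_zero, add_zero] at h2
    rw [iteratedDeriv_const_mul_field]
    simp only [mul_comm _ ((1 / 2 : ℝ) ^ n)]
    rw [h2]
    ring
  have hnn := iteratedDeriv_nonneg_of_vanishing hsm m
    (fun k hk => by
      rw [hder, hpe, Finset.prod_eq_zero (Finset.mem_range.2 hk) (by simp), zero_mul])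
    (fun b hb => h b hb p fun x _ => by rw [hpe]; exact Finset.prod_nonneg fun _ _ => sq_nonneg _)
  rw [hder] at hnn
  refine nonneg_of_mul_nonneg_right hnn ?_
  rw [hpe]
  refine Finset.prod_pos fun k hk => ?_
  have : (1 / 2 : ℝ) ^ m < (1 / 2) ^ k :=
    pow_lt_pow_right_of_lt_one₀ (by norm_num) (by norm_num) (Finset.mem_range.1 hk)
  exact sq_pos_of_neg (by linarith)

/-! ### Smoothing a monotone function. -/

/-- Mollification of a monotone function from the right. -/
theorem exists_contDiff_between {Φ : ℝ → ℝ} (hΦ : Monotone Φ)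
    (hpos : ∀ a, 0 < a → ∀ b, 0 < b → ∀ p : ℝ[X], (∀ x ∈ Icc (-1 : ℝ) 1, 0 ≤ p.eval x) →
      0 ≤ ∑ n ∈ p.support, p.coeff n * Φ (a + b * (1 / 2) ^ n)) {ε : ℝ} (hε : 0 < ε) :
    ∃ f : ℝ → ℝ, ContDiff ℝ ∞ f ∧ (∀ m x, 0 ≤ x → 0 ≤ iteratedDeriv m f x) ∧
      ∀ x, Φ x ≤ f x ∧ f x ≤ Φ (x + 3 * ε) := by
  let η : ContDiffBump (0 : ℝ) := ⟨ε / 2, ε, by linarith, by linarith⟩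
  set w : ℝ → ℝ := η.normed volume with hw
  have hwc : HasCompactSupport w := η.hasCompactSupport_normed
  have hws : ContDiff ℝ ∞ w := η.contDiff_normed
  have hw0 : ∀ t, 0 ≤ w t := η.nonneg_normed
  have hw1 : ∫ t, w t = 1 := η.integral_normed
  have hwi : Integrable w := η.integrable_normed
  have hwt : ∀ t, w t ≠ 0 → |t| < ε := by
    intro t ht
    have : t ∈ Function.support (η.normed volume) := ht
    rw [η.support_normed_eq] at this
    simpa using this
  have hloc : LocallyIntegrable Φ volume := hΦ.locallyIntegrable
  -- Since `w` lives on `|t| < ε`, the shift by `2 * ε` keeps the argument in `(x + ε, x + 3 * ε)`: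
  -- above `x` for the lower bound, and positive even at `x = 0`, where `hpos` is needed.
  set f : ℝ → ℝ := fun x => ∫ t, w t * Φ (x + 2 * ε - t) with hf
  have hfconv : f = fun x => (w ⋆[ContinuousLinearMap.lsmul ℝ ℝ, volume] Φ) (x + 2 * ε) := by
    funext x
    simp [hf, convolution_def]
  have hint : ∀ x, Integrable (fun t => w t * Φ (x + 2 * ε - t)) := by
    intro x
    have := (hwc.convolutionExists_left (ContinuousLinearMap.lsmul ℝ ℝ) hws.continuous hloc)
      (x + 2 * ε)
    simpa [ConvolutionExistsAt] using this
  have hsm : ContDiff ℝ ∞ f := by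
    rw [hfconv]
    exact (hwc.contDiff_convolution_left (ContinuousLinearMap.lsmul ℝ ℝ) hws hloc).comp
      (by fun_prop)
  refine ⟨f, hsm, fun m x hx => ?_, fun x => ⟨?_, ?_⟩⟩
  · refine iteratedDeriv_nonneg_of_polynomial hsm x (fun b hb p hp => ?_) m
    have h1 : ∑ n ∈ p.support, p.coeff n * f (x + b * (1 / 2) ^ n)
        = ∫ t, w t * ∑ n ∈ p.support, p.coeff n * Φ ((x + 2 * ε - t) + b * (1 / 2) ^ n) := by
      simp only [hf, ← integral_const_mul]
      rw [← integral_finsetSum _ fun n _ => (hint _).const_mul _]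
      refine integral_congr_ae (Eventually.of_forall fun t => ?_)
      simp only [Finset.mul_sum]
      refine Finset.sum_congr rfl fun n _ => ?_
      rw [show x + b * (1 / 2 : ℝ) ^ n + 2 * ε - t = x + 2 * ε - t + b * (1 / 2) ^ n by ring]
      ring
    rw [h1]
    refine integral_nonneg fun t => ?_
    by_cases ht : w t = 0
    · simp [ht]
    · have := abs_lt.1 (hwt t ht)
      exact mul_nonneg (hw0 t) (hpos _ (by linarith [this.2]) b hb p hp)
  · calc Φ x = ∫ t, w t * Φ x := by rw [integral_mul_const, hw1, one_mul]
      _ ≤ f x := by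
        refine integral_mono (hwi.mul_const _) (hint x) fun t => ?_
        by_cases ht : w t = 0
        · simp [ht]
        · have := abs_lt.1 (hwt t ht)
          exact mul_le_mul_of_nonneg_left (hΦ (by linarith [this.2])) (hw0 t)
  · calc
      f x ≤ ∫ t, w t * Φ (x + 3 * ε) := by
        refine integral_mono (hint x) (hwi.mul_const _) fun t => ?_
        by_cases ht : w t = 0
        · simp [ht]
        · have := abs_lt.1 (hwt t ht)
          exact mul_le_mul_of_nonneg_left (hΦ (by linarith [this.1])) (hw0 t)
      _ = Φ (x + 3 * ε) := by rw [integral_mul_const, hw1, one_mul]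

/-! ### Bernstein's theorem on the half-line. -/

theorem exists_taylor_lagrange {f : ℝ → ℝ} (hf : ContDiff ℝ ∞ f) {x₀ x : ℝ} (hx : x₀ < x)
    (n : ℕ) : ∃ ξ ∈ Ioo x₀ x, f x =
      ∑ k ∈ Finset.range (n + 1), iteratedDeriv k f x₀ / k ! * (x - x₀) ^ k +
        iteratedDeriv (n + 1) f ξ / (n + 1)! * (x - x₀) ^ (n + 1) := by
  obtain ⟨ξ, hξ, h⟩ := taylor_mean_remainder_lagrange_iteratedDeriv (n := n) hx.ne
    (hf.of_le (by exact_mod_cast le_top)).contDiffOn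
  rw [uIoo_of_lt hx] at hξ
  refine ⟨ξ, hξ, ?_⟩
  rw [uIcc_of_le hx.le, taylor_within_apply] at h
  have h' : ∑ k ∈ Finset.range (n + 1), ((k ! : ℝ)⁻¹ * (x - x₀) ^ k) •
      iteratedDerivWithin k f (Icc x₀ x) x₀ =
      ∑ k ∈ Finset.range (n + 1), iteratedDeriv k f x₀ / k ! * (x - x₀) ^ k := by
    refine Finset.sum_congr rfl fun k _ => ?_
    rw [iteratedDerivWithin_eq_iteratedDeriv (uniqueDiffOn_Icc hx)
      (hf.of_le (by exact_mod_cast le_top)).contDiffAt (left_mem_Icc.2 hx.le), smul_eq_mul]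
    ring
  rw [h', sub_eq_iff_eq_add] at h
  rw [h]
  ring

/-- Bernstein's theorem on the half-line: a smooth function all of whose derivatives are
nonnegative on `[0, ∞)` is the sum of its Taylor series at `0` there. -/
theorem hasSum_taylor_of_iteratedDeriv_nonneg {f : ℝ → ℝ} (hf : ContDiff ℝ ∞ f)
    (h : ∀ m x, 0 ≤ x → 0 ≤ iteratedDeriv m f x) {x : ℝ} (hx : 0 ≤ x) :
    HasSum (fun k => iteratedDeriv k f 0 / k ! * x ^ k) (f x) := by
  rcases hx.eq_or_lt with rfl | hx
  · convert hasSum_single (f := fun k => iteratedDeriv k f 0 / k ! * (0 : ℝ) ^ k) 0 ?_ using 1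
    · simp
    · intro k hk
      simp [hk]
  have hmono : ∀ m, MonotoneOn (iteratedDeriv m f) (Ici 0) := by
    intro m
    have hd : Differentiable ℝ (iteratedDeriv m f) :=
      hf.differentiable_iteratedDeriv m (by exact_mod_cast WithTop.coe_lt_top _)
    refine monotoneOn_of_deriv_nonneg (convex_Ici 0) hd.continuous.continuousOn
      hd.differentiableOn fun y hy => ?_
    rw [← iteratedDeriv_succ]
    exact h _ _ (interior_subset hy)
  have hnn : ∀ k, 0 ≤ iteratedDeriv k f 0 / k ! * x ^ k := fun k =>
    mul_nonneg (div_nonneg (h k 0 le_rfl) (by positivity)) (by positivity)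
  rw [hasSum_iff_tendsto_nat_of_nonneg hnn, ← tendsto_add_atTop_iff_nat 1]
  -- Expanding from `x` to `3 * x` gives a step of `2 * x`; against the step `x` of the remainder at
  -- `0` this gains the factor `(1 / 2) ^ (n + 1)`.
  have hbd : ∀ n : ℕ, iteratedDeriv (n + 1) f x / (n + 1)! * (2 * x) ^ (n + 1) ≤ f (3 * x) := by
    intro n
    obtain ⟨ξ, hξ, he⟩ := exists_taylor_lagrange hf (x₀ := x) (x := 3 * x) (by linarith) (n + 1)
    rw [Finset.sum_range_succ, show 3 * x - x = 2 * x by ring] at he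
    have h1 : 0 ≤ ∑ k ∈ Finset.range (n + 1), iteratedDeriv k f x / k ! * (2 * x) ^ k :=
      Finset.sum_nonneg fun k _ =>
        mul_nonneg (div_nonneg (h k x hx.le) (by positivity)) (by positivity)
    have h2 : 0 ≤ iteratedDeriv (n + 1 + 1) f ξ / (n + 1 + 1)! * (2 * x) ^ (n + 1 + 1) :=
      mul_nonneg (div_nonneg (h _ ξ (hx.trans hξ.1).le) (by positivity)) (by positivity)
    linarith
  have hlow : Tendsto (fun n : ℕ => f x - f (3 * x) * (1 / 2) ^ (n + 1)) atTop (𝓝 (f x)) := by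
    have := ((tendsto_pow_atTop_nhds_zero_of_lt_one (r := (1 / 2 : ℝ)) (by norm_num)
      (by norm_num)).comp (tendsto_add_atTop_nat 1)).const_mul (f (3 * x))
    simpa using this.const_sub (f x)
  refine tendsto_of_tendsto_of_tendsto_of_le_of_le hlow tendsto_const_nhds ?_ ?_
  · intro n
    obtain ⟨ξ, hξ, he⟩ := exists_taylor_lagrange hf hx n
    rw [sub_zero] at he
    have h1 : iteratedDeriv (n + 1) f ξ / (n + 1)! * x ^ (n + 1) ≤
        iteratedDeriv (n + 1) f x / (n + 1)! * x ^ (n + 1) := by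
      have := hmono (n + 1) (mem_Ici.2 hξ.1.le) (mem_Ici.2 hx.le) hξ.2.le
      gcongr
    have h2 : iteratedDeriv (n + 1) f x / (n + 1)! * x ^ (n + 1) ≤
        f (3 * x) * (1 / 2) ^ (n + 1) := by
      have := mul_le_mul_of_nonneg_right (hbd n) (by positivity : (0 : ℝ) ≤ (1 / 2) ^ (n + 1))
      rwa [mul_assoc, ← mul_pow, show 2 * x * (1 / 2) = x by ring] at this
    simp only
    linarith
  · intro n
    obtain ⟨ξ, hξ, he⟩ := exists_taylor_lagrange hf hx n
    rw [sub_zero] at he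
    have := mul_nonneg (div_nonneg (h (n + 1) ξ hξ.1.le) (by positivity : (0 : ℝ) ≤ (n + 1)!))
      (by positivity : 0 ≤ x ^ (n + 1))
    simp only
    linarith

/-! ### Passing to the limit in the power series. -/

/-- A monotone function squeezed by nonnegative power series at every scale is itself given by a
nonnegative power series on `(0, ∞)`. -/
theorem exists_hasSum_of_squeeze {Φ : ℝ → ℝ} (hΦ : Monotone Φ)
    (h : ∀ ε, 0 < ε → ∃ (c : ℕ → ℝ) (f : ℝ → ℝ), (∀ k, 0 ≤ c k) ∧
      ∀ x, 0 ≤ x → HasSum (fun k => c k * x ^ k) (f x) ∧ Φ x ≤ f x ∧ f x ≤ Φ (x + 3 * ε)) :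
    ∃ c : ℕ → ℝ, (∀ k, 0 ≤ c k) ∧ ∀ x, 0 < x → HasSum (fun k => c k * x ^ k) (Φ x) := by
  have hε : ∀ n : ℕ, (0 : ℝ) < 1 / (n + 1) := fun n => by positivity
  choose c f hc hf using fun n : ℕ => h _ (hε n)
  have hε1 : ∀ n : ℕ, (1 : ℝ) / (n + 1) ≤ 1 := fun n => by
    rw [div_le_one (by positivity)]
    linarith [n.cast_nonneg (α := ℝ)]
  have hbd : ∀ n k, ∀ R, 0 ≤ R → c n k * R ^ k ≤ Φ (R + 3) := fun n k R hR =>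
    calc c n k * R ^ k ≤ f n R :=
          le_hasSum (hf n R hR).1 k fun j _ => mul_nonneg (hc n j) (by positivity)
      _ ≤ Φ (R + 3 * (1 / (n + 1))) := (hf n R hR).2.2
      _ ≤ Φ (R + 3) := hΦ (by linarith [hε1 n])
  -- Bounded coefficients converge along an ultrafilter for all `k` at once, which replaces a
  -- diagonal subsequence.
  let U : Ultrafilter ℕ := hyperfilter ℕ
  have hU : (U : Filter ℕ) ≤ atTop := Nat.hyperfilter_le_atTop
  have hlim : ∀ k, ∃ l, 0 ≤ l ∧ Tendsto (fun n => c n k) U (𝓝 l) := by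
    intro k
    obtain ⟨l, hl, hle⟩ := (isCompact_Icc (a := (0 : ℝ)) (b := Φ (1 + 3))).ultrafilter_le_nhds
      (U.map fun n => c n k) (by
        refine le_principal_iff.2 (mem_map.2 (Eventually.of_forall fun n => ?_))
        exact ⟨hc n k, by simpa using hbd n k 1 zero_le_one⟩)
    exact ⟨l, hl.1, hle⟩
  choose l hl0 hl using hlim
  refine ⟨l, hl0, ?_⟩
  have hdom : ∀ x, 0 ≤ x → ∀ n k, ‖c n k * x ^ k‖ ≤ Φ (2 * (x + 1) + 3) * (1 / 2) ^ k := by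
    intro x hx n k
    rw [Real.norm_of_nonneg (mul_nonneg (hc n k) (by positivity))]
    have h1 := hbd n k (2 * (x + 1)) (by positivity)
    have h2 : c n k * x ^ k ≤ c n k * (2 * (x + 1)) ^ k * (1 / 2) ^ k := by
      rw [mul_assoc, ← mul_pow]
      refine mul_le_mul_of_nonneg_left ?_ (hc n k)
      exact pow_le_pow_left₀ hx (by linarith) k
    exact h2.trans (mul_le_mul_of_nonneg_right h1 (by positivity))
  have hgeo : ∀ C : ℝ, Summable fun k : ℕ => C * (1 / 2 : ℝ) ^ k := fun C =>
    (summable_geometric_of_lt_one (by norm_num) (by norm_num)).mul_left C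
  have hlx : ∀ x, 0 ≤ x → ∀ k, ‖l k * x ^ k‖ ≤ Φ (2 * (x + 1) + 3) * (1 / 2) ^ k :=
    fun x hx k => le_of_tendsto ((hl k).mul_const (x ^ k)).norm
      (Eventually.of_forall fun n => hdom x hx n k)
  have hsum : ∀ x, 0 ≤ x → Summable fun k => l k * x ^ k := fun x hx =>
    (hgeo _).of_norm_bounded (hlx x hx)
  set g : ℝ → ℝ := fun x => ∑' k, l k * x ^ k with hg
  have hfg : ∀ x, 0 ≤ x → Tendsto (fun n => f n x) U (𝓝 (g x)) := by
    intro x hx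
    have := tendsto_tsum_of_dominated_convergence (𝓕 := (U : Filter ℕ))
      (f := fun n k => c n k * x ^ k) (g := fun k => l k * x ^ k)
      (hgeo (Φ (2 * (x + 1) + 3))) (fun k => (hl k).mul_const _)
      (Eventually.of_forall fun n k => hdom x hx n k)
    simpa only [(hf _ x hx).1.tsum_eq] using this
  have hge : ∀ x, 0 ≤ x → Φ x ≤ g x := fun x hx =>
    ge_of_tendsto (hfg x hx) (Eventually.of_forall fun n => (hf n x hx).2.1)
  -- The shift `3 * ε` costs a strict inequality `x < y`, as `Φ` could jump; left continuity of `g`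
  -- removes it below.
  have hlt : ∀ x y, 0 ≤ x → x < y → g x ≤ Φ y := by
    intro x y hx hxy
    refine le_of_tendsto (hfg x hx) (hU ?_)
    have h3 : Tendsto (fun n : ℕ => x + 3 * (1 / ((n : ℝ) + 1))) atTop (𝓝 x) := by
      simpa using (tendsto_one_div_add_atTop_nhds_zero_nat (𝕜 := ℝ)).const_mul 3 |>.const_add x
    filter_upwards [h3.eventually (gt_mem_nhds hxy)] with n hn
    exact (hf n x hx).2.2.trans (hΦ hn.le)
  intro x hx
  have hcont : ContinuousOn g (Icc 0 x) := by
    refine continuousOn_tsum (u := fun k => Φ (2 * (x + 1) + 3) * (1 / 2) ^ k) (by fun_prop)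
      (hgeo _) fun k y hy => ?_
    refine le_trans ?_ (hlx x hx.le k)
    rw [norm_mul, norm_mul, norm_pow, norm_pow, Real.norm_of_nonneg hy.1,
      Real.norm_of_nonneg hx.le]
    exact mul_le_mul_of_nonneg_left (pow_le_pow_left₀ hy.1 hy.2 k) (norm_nonneg _)
  have hle : g x ≤ Φ x := by
    have ht : Tendsto g (𝓝[<] x) (𝓝 (g x)) := by
      have h1 := hcont x (right_mem_Icc.2 hx.le)
      rw [ContinuousWithinAt, nhdsWithin_Icc_eq_nhdsLE hx] at h1
      exact h1.mono_left (nhdsWithin_mono x Iio_subset_Iic_self)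
    refine le_of_tendsto ht ?_
    filter_upwards [Ioo_mem_nhdsLT hx] with y hy
    exact hlt y x hy.1.le hy.2
  rw [le_antisymm (hge x hx.le) hle]
  exact (hsum x hx.le).hasSum

/-! ### Absolutely monotonic entire functions as power series. -/

/-- The complex numbers that are nonnegative reals form a closed set. -/
theorem isClosed_nonneg_ofReal : IsClosed {z : ℂ | ∃ c : ℝ, 0 ≤ c ∧ z = c} := by
  have : {z : ℂ | ∃ c : ℝ, 0 ≤ c ∧ z = c} = {z : ℂ | 0 ≤ z.re} ∩ {z : ℂ | z.im = 0} := by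
    ext z
    constructor
    · rintro ⟨c, hc, rfl⟩
      simpa using hc
    · rintro ⟨h1, h2⟩
      exact ⟨z.re, h1, by apply Complex.ext <;> simp_all⟩
  rw [this]
  exact (isClosed_le continuous_const Complex.continuous_re).inter
    (isClosed_eq Complex.continuous_im continuous_const)

theorem AbsMonotonicEntire.exists_hasSum {G : ℂ → ℂ} (hG : AbsMonotonicEntire G) {F : ℝ → ℝ}
    (hF : ∀ x : ℝ, G x = F x) :
    ∃ c : ℕ → ℝ, (∀ k, 0 ≤ c k) ∧ ∀ x : ℝ, HasSum (fun k => c k * x ^ k) (F x) := by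
  have hcoef : ∀ n : ℕ, ∃ c : ℝ, 0 ≤ c ∧ iteratedDeriv n G 0 / (n ! : ℂ) = c := by
    intro n
    have hc : Continuous fun x : ℝ => iteratedDeriv n G (x : ℂ) / (n ! : ℂ) :=
      -- The hypothesis concerns only points `x > 0`; the coefficient at `0` is reached by letting
      -- `x → 0⁺`.
      ((hG.1.contDiff.continuous_iteratedDeriv n le_rfl).comp Complex.continuous_ofReal).div_const _
    have ht := (hc.tendsto 0).mono_left (nhdsWithin_le_nhds (s := Ioi 0))
    have := isClosed_nonneg_ofReal.mem_of_tendsto ht (by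
      filter_upwards [self_mem_nhdsWithin] with x hx
      exact hG.2 x hx n)
    simpa using this
  choose c hc0 hc using hcoef
  refine ⟨c, hc0, fun x => ?_⟩
  have h := Complex.hasSum_taylorSeries_of_entire hG.1 0 (x : ℂ)
  rw [hF] at h
  rw [← Complex.hasSum_ofReal]
  have he : (fun k => ((c k * x ^ k : ℝ) : ℂ)) =
      fun k => (k ! : ℂ)⁻¹ • ((x : ℂ) - 0) ^ k • iteratedDeriv k G 0 := by
    funext k
    push_cast
    rw [← hc, smul_eq_mul, smul_eq_mul, sub_zero]
    ring
  rw [he]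
  exact h

theorem nonneg_ofReal_iteratedDeriv {G : ℂ → ℂ} (hG : Differentiable ℂ G)
    (h : ∀ k, ∃ c : ℝ, 0 ≤ c ∧ iteratedDeriv k G 0 = c) {x : ℝ} (hx : 0 ≤ x) :
    ∃ c : ℝ, 0 ≤ c ∧ G x = c := by
  choose c hc0 hc using h
  have hs := Complex.hasSum_taylorSeries_of_entire hG 0 (x : ℂ)
  refine isClosed_nonneg_ofReal.mem_of_tendsto hs (Eventually.of_forall fun s => ?_)
  refine ⟨∑ k ∈ s, (k ! : ℝ)⁻¹ * (x ^ k * c k), Finset.sum_nonneg fun k _ =>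
    mul_nonneg (by positivity) (mul_nonneg (by positivity) (hc0 k)), ?_⟩
  push_cast
  refine Finset.sum_congr rfl fun k _ => ?_
  rw [hc, smul_eq_mul, smul_eq_mul, sub_zero]

/-- An everywhere convergent power series with nonnegative coefficients defines an absolutely
monotonic entire function. -/
theorem exists_absMonotonicEntire {c : ℕ → ℝ} (hc : ∀ k, 0 ≤ c k) {F : ℝ → ℝ}
    (hF : ∀ x : ℝ, HasSum (fun k => c k * x ^ k) (F x)) :
    ∃ G : ℂ → ℂ, AbsMonotonicEntire G ∧ ∀ x : ℝ, G x = F x := by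
  set p : FormalMultilinearSeries ℂ ℂ ℂ :=
    FormalMultilinearSeries.ofScalars ℂ (fun k => (c k : ℂ)) with hp
  have hrad : p.radius = ⊤ := by
    refine FormalMultilinearSeries.radius_eq_top_of_summable_norm _ fun r => ?_
    simpa [hp, FormalMultilinearSeries.ofScalars_norm, abs_of_nonneg (hc _)] using (hF r).summable
  have hball : HasFPowerSeriesOnBall p.sum p 0 ⊤ := by
    have := p.hasFPowerSeriesOnBall (by simp [hrad])
    rwa [hrad] at this
  have hsum : ∀ z, HasSum (fun k => (c k : ℂ) * z ^ k) (p.sum z) := by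
    intro z
    have := hball.hasSum (y := z) (by simp)
    simpa [hp, FormalMultilinearSeries.ofScalars_apply_eq, mul_comm] using this
  have hdiff : Differentiable ℂ p.sum := fun z =>
    (hball.differentiableOn z (by simp)).differentiableAt (by simp)
  have hder : ∀ k, iteratedDeriv k p.sum 0 = (k ! : ℂ) * c k := by
    intro k
    have h1 := hball.factorial_smul 1 k
    rw [iteratedDeriv_eq_iteratedFDeriv, ← h1]
    simp [hp]
  refine ⟨p.sum, ⟨hdiff, fun x hx n => ?_⟩, fun x => ?_⟩
  · have hd : Differentiable ℂ (iteratedDeriv n p.sum) :=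
      hdiff.contDiff.differentiable_iteratedDeriv n (WithTop.coe_lt_top _)
    obtain ⟨r, hr, he⟩ := nonneg_ofReal_iteratedDeriv hd (fun k => by
      refine ⟨((k + n)! : ℝ) * c (k + n), mul_nonneg (by positivity) (hc _), ?_⟩
      have : iteratedDeriv k (iteratedDeriv n p.sum) = iteratedDeriv (k + n) p.sum := by
        simp only [iteratedDeriv_eq_iterate, Function.iterate_add_apply]
      rw [this, hder]
      push_cast
      rfl) hx.le
    exact ⟨r / n !, by positivity, by rw [he]; push_cast; rfl⟩
  · refine (hsum x).unique ?_
    have := Complex.hasSum_ofReal.2 (hF x)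
    simpa using this

/-! ### Moment sequences on `[-1, 1]`. -/

/-- `m` is the moment sequence of a finite measure on `[-1, 1]`. -/
def IsIntervalMoment (m : ℕ → ℝ) : Prop :=
  ∃ σ : Measure ℝ, IsFiniteMeasure σ ∧ σ (Icc (-1) 1)ᶜ = 0 ∧ ∀ n : ℕ, ∫ x, x ^ n ∂σ = m n

theorem integrable_of_continuous_of_compl_null {X : Type*} [TopologicalSpace X]
    [MeasurableSpace X] [OpensMeasurableSpace X] {K : Set X} (hK : IsCompact K)
    {σ : Measure X} [IsFiniteMeasure σ] (hσ : σ Kᶜ = 0) {g : X → ℝ} (hg : Continuous g) :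
    Integrable g σ := by
  obtain ⟨C, hC⟩ := hK.exists_bound_of_continuousOn hg.continuousOn
  refine Integrable.of_bound hg.measurable.aestronglyMeasurable C ?_
  filter_upwards [measure_eq_zero_iff_ae_notMem.1 hσ] with x hx
  exact hC x (not_not.1 hx)

theorem ae_mem_of_compl_null {X : Type*} [MeasurableSpace X] {K : Set X} {σ : Measure X}
    (hσ : σ Kᶜ = 0) : ∀ᵐ x ∂σ, x ∈ K := by
  filter_upwards [measure_eq_zero_iff_ae_notMem.1 hσ] with x hx
  exact not_not.1 hx

theorem integral_polynomial_eval {σ : Measure ℝ} [IsFiniteMeasure σ]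
    (hσ : σ (Icc (-1) 1)ᶜ = 0) (p : ℝ[X]) :
    ∫ x, p.eval x ∂σ = ∑ n ∈ p.support, p.coeff n * ∫ x, x ^ n ∂σ := by
  simp only [Polynomial.eval_eq_sum, Polynomial.sum, ← integral_const_mul]
  exact integral_finsetSum _ fun n _ =>
    (integrable_of_continuous_of_compl_null isCompact_Icc hσ (by fun_prop)).const_mul _

theorem IsIntervalMoment.sum_nonneg {m : ℕ → ℝ} (hm : IsIntervalMoment m) {p : ℝ[X]}
    (hp : ∀ x ∈ Icc (-1 : ℝ) 1, 0 ≤ p.eval x) : 0 ≤ ∑ n ∈ p.support, p.coeff n * m n := by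
  obtain ⟨σ, _, hσ, h⟩ := hm
  simp only [← h]
  rw [← integral_polynomial_eval hσ]
  exact integral_nonneg_of_ae ((ae_mem_of_compl_null hσ).mono hp)

theorem IsIntervalMoment.zero_nonneg {m : ℕ → ℝ} (hm : IsIntervalMoment m) : 0 ≤ m 0 := by
  obtain ⟨σ, _, hσ, h⟩ := hm
  rw [← h]
  simp

theorem IsIntervalMoment.le_zero {m : ℕ → ℝ} (hm : IsIntervalMoment m) (n : ℕ) :
    m n ≤ m 0 := by
  obtain ⟨σ, _, hσ, h⟩ := hm
  rw [← h, ← h]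
  have hi : ∀ n : ℕ, Integrable (fun x : ℝ => x ^ n) σ := fun n =>
    integrable_of_continuous_of_compl_null isCompact_Icc hσ (by fun_prop)
  refine integral_mono_ae (hi n) (hi 0) ?_
  filter_upwards [ae_mem_of_compl_null hσ] with x hx
  have : |x| ^ n ≤ 1 := pow_le_one₀ (abs_nonneg x) (abs_le.2 hx)
  simpa using (le_abs_self _).trans ((abs_pow x n).le.trans this)

/-- On `[-1, 1]` the integrand is bounded by `1` and tends to `0`, at `x = 0` thanks to the factor
`x`. It equals `x` plus odd powers of degree at least `3`, so it recovers the first moment from the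
others. -/
theorem tendsto_integral_mul_one_sub_sq_pow {σ : Measure ℝ} [IsFiniteMeasure σ]
    (hσ : σ (Icc (-1) 1)ᶜ = 0) :
    Tendsto (fun k : ℕ => ∫ x, x * (1 - x ^ 2) ^ k ∂σ) atTop (𝓝 0) := by
  have key := tendsto_integral_of_dominated_convergence (μ := σ)
    (F := fun (k : ℕ) x => x * (1 - x ^ 2) ^ k) (f := fun _ => (0 : ℝ)) (fun _ => 1)
    (fun k => (by fun_prop : Continuous _).aestronglyMeasurable) (integrable_const 1)
    (fun k => ?_) ?_
  · simpa using key
  · filter_upwards [ae_mem_of_compl_null hσ] with x hx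
    have h2 : x ^ 2 ≤ 1 := by rw [sq_le_one_iff_abs_le_one]; exact abs_le.2 hx
    rw [Real.norm_eq_abs, abs_mul, abs_pow, abs_of_nonneg (sub_nonneg.2 h2)]
    exact mul_le_one₀ (abs_le.2 hx) (pow_nonneg (sub_nonneg.2 h2) k)
      (pow_le_one₀ (sub_nonneg.2 h2) (by linarith [sq_nonneg x]))
  · filter_upwards [ae_mem_of_compl_null hσ] with x hx
    rcases eq_or_ne x 0 with rfl | h0
    · simp
    have h2 : x ^ 2 ≤ 1 := by rw [sq_le_one_iff_abs_le_one]; exact abs_le.2 hx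
    have h3 : 0 < x ^ 2 := by positivity
    simpa using (tendsto_pow_atTop_nhds_zero_of_lt_one (sub_nonneg.2 h2)
      (by linarith)).const_mul x

/-- The moments of order `≠ 1` of a measure on `[-1, 1]` determine the first moment. -/
theorem IsIntervalMoment.one_eq {m m' : ℕ → ℝ} (hm : IsIntervalMoment m)
    (hm' : IsIntervalMoment m') (h : ∀ n, n ≠ 1 → m n = m' n) : m 1 = m' 1 := by
  obtain ⟨σ, _, hσ, hs⟩ := hm
  obtain ⟨τ, _, hτ, ht⟩ := hm'
  have hexp : ∀ (ρ : Measure ℝ) [IsFiniteMeasure ρ], ρ (Icc (-1) 1)ᶜ = 0 → ∀ k : ℕ,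
      ∫ x, x * (1 - x ^ 2) ^ k ∂ρ = ∫ x, x ^ 1 ∂ρ + ∑ j ∈ Finset.range k,
        ((-1) ^ (j + 1) * (k.choose (j + 1) : ℝ)) * ∫ x, x ^ (2 * (j + 1) + 1) ∂ρ := by
    intro ρ _ hρ k
    have hi : ∀ n : ℕ, Integrable (fun x : ℝ => x ^ n) ρ := fun n =>
      integrable_of_continuous_of_compl_null isCompact_Icc hρ (by fun_prop)
    simp only [← integral_const_mul]
    rw [← integral_finsetSum _ fun j _ => (hi _).const_mul _,
      ← integral_add (hi 1) (integrable_finsetSum _ fun j _ => (hi _).const_mul _)]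
    refine integral_congr_ae (Eventually.of_forall fun x => ?_)
    simp only
    rw [show (1 : ℝ) - x ^ 2 = -x ^ 2 + 1 by ring, add_pow, Finset.sum_range_succ', mul_add,
      add_comm, Finset.mul_sum]
    congr 1
    · simp
    · refine Finset.sum_congr rfl fun j _ => ?_
      rw [neg_pow, one_pow, ← pow_mul]
      ring
  have hd : ∀ k : ℕ, ∫ x, x * (1 - x ^ 2) ^ k ∂σ - ∫ x, x * (1 - x ^ 2) ^ k ∂τ = m 1 - m' 1 := by
    intro k
    rw [hexp σ hσ, hexp τ hτ]
    simp only [hs, ht]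
    rw [Finset.sum_congr rfl fun j _ => by rw [h (2 * (j + 1) + 1) (by omega)]]
    ring
  have hl := (tendsto_integral_mul_one_sub_sq_pow hσ).sub (tendsto_integral_mul_one_sub_sq_pow hτ)
  simp only [hd, sub_zero] at hl
  exact sub_eq_zero.1 (tendsto_nhds_unique tendsto_const_nhds hl)

/-! ### Sufficiency: multiplicative convolution on the cube. -/

theorem isCompact_cube (d : ℕ) : IsCompact (cube d) := by
  have : cube d = Set.univ.pi fun _ => Icc (-1 : ℝ) 1 := by
    ext x
    simp only [cube, mem_ofPred_eq, mem_univ_pi]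
  rw [this]
  exact isCompact_univ_pi fun _ => isCompact_Icc

theorem continuous_monom {d : ℕ} (α : Fin d → ℕ) : Continuous (monom α) := by
  unfold monom
  fun_prop

theorem monom_mul {d : ℕ} (α : Fin d → ℕ) (x y : Fin d → ℝ) :
    monom α (x * y) = monom α x * monom α y := by
  simp [monom, mul_pow, Finset.prod_mul_distrib]

theorem mul_mem_cube {d : ℕ} {x y : Fin d → ℝ} (hx : x ∈ cube d) (hy : y ∈ cube d) :
    x * y ∈ cube d := fun i => by
  rw [Pi.mul_apply, mem_Icc, ← abs_le, abs_mul]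
  exact mul_le_one₀ (abs_le.2 (hx i)) (abs_nonneg _) (abs_le.2 (hy i))

theorem admissible_of_isFiniteMeasure {d : ℕ} {μ : Measure (Fin d → ℝ)} [IsFiniteMeasure μ]
    (hμ : μ (cube d)ᶜ = 0) : Admissible μ := fun α =>
  integrable_of_continuous_of_compl_null (isCompact_cube d) hμ (continuous_monom α)

theorem Admissible.isFiniteMeasure {d : ℕ} {μ : Measure (Fin d → ℝ)} (hμ : Admissible μ) :
    IsFiniteMeasure μ := by
  have h := hμ 0
  have h1 : monom (0 : Fin d → ℕ) = fun _ => (1 : ℝ) := by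
    funext x
    simp [monom]
  rw [h1, integrable_const_iff] at h
  simpa using h

/-- Iterated multiplicative self-convolution. -/
noncomputable def mconvPow {d : ℕ} (μ : Measure (Fin d → ℝ)) : ℕ → Measure (Fin d → ℝ)
  | 0 => Measure.dirac 1
  | k + 1 => μ.mconv (mconvPow μ k)

instance {d : ℕ} (μ : Measure (Fin d → ℝ)) [IsFiniteMeasure μ] (k : ℕ) :
    IsFiniteMeasure (mconvPow μ k) := by
  induction k with
  | zero => unfold mconvPow; infer_instance
  | succ k ih => unfold mconvPow; infer_instance

theorem mconvPow_compl_cube {d : ℕ} {μ : Measure (Fin d → ℝ)} [IsFiniteMeasure μ]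
    (hμ : μ (cube d)ᶜ = 0) (k : ℕ) : mconvPow μ k (cube d)ᶜ = 0 := by
  have hK := (isCompact_cube d).measurableSet.compl
  induction k with
  | zero =>
    have h1 : (1 : Fin d → ℝ) ∈ cube d := fun i => by simp
    simp [mconvPow, Measure.dirac_apply' _ hK, h1]
  | succ k ih =>
    rw [mconvPow, Measure.mconv, Measure.map_apply (by fun_prop) hK]
    refine measure_mono_null (t := Prod.fst ⁻¹' (cube d)ᶜ ∪ Prod.snd ⁻¹' (cube d)ᶜ) ?_
      (measure_union_null (Measure.quasiMeasurePreserving_fst.preimage_null hμ)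
        (Measure.quasiMeasurePreserving_snd.preimage_null ih))
    rintro ⟨x, y⟩ hxy
    by_contra hc
    simp only [mem_union, mem_preimage, mem_compl_iff, not_or, not_not] at hc
    exact hxy (mul_mem_cube hc.1 hc.2)

/-- Multiplicativity of monomials turns convolution of measures into the product of moments, by
Fubini. -/
theorem momentFamily_mconvPow {d : ℕ} (μ : Measure (Fin d → ℝ)) [IsFiniteMeasure μ]
    (k : ℕ) (α : Fin d → ℕ) :
    momentFamily (mconvPow μ k) α = momentFamily μ α ^ k := by
  induction k with
  | zero => simp [momentFamily, mconvPow, monom]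
  | succ k ih =>
    rw [momentFamily, mconvPow, Measure.mconv, integral_map (by fun_prop)
      (continuous_monom α).measurable.aestronglyMeasurable]
    simp only [monom_mul]
    rw [integral_prod_mul, pow_succ', ← ih]
    rfl

/-- A power series with nonnegative coefficients maps moment families on the cube to moment
families on the cube. -/
theorem comp_mem_momentSet_of_hasSum {d : ℕ} {c : ℕ → ℝ} (hc : ∀ k, 0 ≤ c k) {F : ℝ → ℝ}
    (hF : ∀ x : ℝ, HasSum (fun k => c k * x ^ k) (F x)) {s : (Fin d → ℕ) → ℝ}
    (hs : s ∈ momentSet (cube d)) : (fun α => F (s α)) ∈ momentSet (cube d) := by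
  obtain ⟨μ, hμ, hK, rfl⟩ := hs
  have := hμ.isFiniteMeasure
  set ν : ℕ → Measure (Fin d → ℝ) := fun k => ENNReal.ofReal (c k) • mconvPow μ k with hν
  have hνi : ∀ k α, ∫ x, monom α x ∂ν k = c k * momentFamily μ α ^ k := by
    intro k α
    rw [hν, integral_smul_measure, ENNReal.toReal_ofReal (hc k), smul_eq_mul,
      ← momentFamily_mconvPow]
    rfl
  have hνK : ∀ k, ν k (cube d)ᶜ = 0 := fun k => by
    simp [hν, mconvPow_compl_cube hK]
  -- The total mass is the series for `F` at the zeroth moment of `μ`, hence finite.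
  have hfin : IsFiniteMeasure (Measure.sum ν) := by
    refine ⟨?_⟩
    rw [Measure.sum_apply _ MeasurableSet.univ]
    have h1 : ∀ k, ν k univ = ENNReal.ofReal (c k * momentFamily μ 0 ^ k) := by
      intro k
      have : IsFiniteMeasure (ν k) := by
        rw [hν]
        exact Measure.smul_finite _ ENNReal.ofReal_ne_top
      rw [← hνi]
      simp [monom, measureReal_def]
    have hm0 : 0 ≤ momentFamily μ 0 := by simp [momentFamily, monom]
    simp only [h1]
    rw [← ENNReal.ofReal_tsum_of_nonneg (fun k => mul_nonneg (hc k) (by positivity))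
      (hF _).summable]
    exact ENNReal.ofReal_lt_top
  have hsK : Measure.sum ν (cube d)ᶜ = 0 := by
    rw [Measure.sum_apply _ (isCompact_cube d).measurableSet.compl]
    simp [hνK]
  have hadm := admissible_of_isFiniteMeasure hsK
  refine ⟨Measure.sum ν, hadm, hsK, ?_⟩
  funext α
  have h2 := hasSum_integral_measure (hadm α)
  simp only [hνi] at h2
  exact h2.unique (hF _)

/-! ### Necessity: two-atom test measures. -/

/-- Testing a transform of moment families on measures with two atoms on a coordinate line. -/
theorem isIntervalMoment_two_atoms {d : ℕ} (i : Fin d) {F : ℝ → ℝ}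
    (hF : ∀ s ∈ momentSet (cube d), (fun α => F (s α)) ∈ momentSet (cube d))
    {a b u : ℝ} (ha : 0 ≤ a) (hb : 0 ≤ b) (hu : u ∈ Icc (-1 : ℝ) 1) :
    IsIntervalMoment fun n => F (a + b * u ^ n) := by
  set v : Fin d → ℝ := Function.update 1 i u with hv
  have hK := (isCompact_cube d).measurableSet.compl
  have h1 : (1 : Fin d → ℝ) ∈ cube d := fun j => by simp
  have hvc : v ∈ cube d := fun j => by
    rcases eq_or_ne j i with rfl | hj
    · simpa [hv] using hu
    · simp [hv, hj]
  set μ : Measure (Fin d → ℝ) :=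
    ENNReal.ofReal a • Measure.dirac 1 + ENNReal.ofReal b • Measure.dirac v with hμ
  have hfin : IsFiniteMeasure μ := by
    have := Measure.smul_finite (Measure.dirac (1 : Fin d → ℝ)) (ENNReal.ofReal_ne_top (r := a))
    have := Measure.smul_finite (Measure.dirac v) (ENNReal.ofReal_ne_top (r := b))
    infer_instance
  have hμK : μ (cube d)ᶜ = 0 := by
    simp [hμ, Measure.dirac_apply' _ hK, h1, hvc]
  have hmon : ∀ (n : ℕ) (x : Fin d → ℝ), monom (Pi.single i n) x = x i ^ n := by
    intro n x
    rw [monom, Finset.prod_eq_single i]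
    · simp
    · intro j _ hj
      simp [hj]
    · simp
  have hmom : ∀ n : ℕ, momentFamily μ (Pi.single i n) = a + b * u ^ n := by
    intro n
    have hi : ∀ w : Fin d → ℝ, ∀ r : ℝ, Integrable (monom (Pi.single i n))
        (ENNReal.ofReal r • Measure.dirac w) := fun w r =>
      (integrable_dirac (by simp)).smul_measure ENNReal.ofReal_ne_top
    rw [momentFamily, hμ, integral_add_measure (hi _ _) (hi _ _), integral_smul_measure,
      integral_smul_measure, integral_dirac, integral_dirac, hmon, hmon,
      ENNReal.toReal_ofReal ha, ENNReal.toReal_ofReal hb]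
    simp [hv]
  obtain ⟨ν, hν, hνK, he⟩ := hF _ ⟨μ, admissible_of_isFiniteMeasure hμK, hμK, rfl⟩
  have := hν.isFiniteMeasure
  refine ⟨ν.map fun x => x i, inferInstance, ?_, fun n => ?_⟩
  · rw [Measure.map_apply (by fun_prop) measurableSet_Icc.compl]
    exact measure_mono_null (fun x (hx : x i ∉ Icc (-1) 1) (hxc : x ∈ cube d) => hx (hxc i))
      hνK
  · rw [integral_map (measurable_pi_apply i).aemeasurable (by fun_prop)]
    have := congrFun he (Pi.single i n)
    simp only [hmom] at this
    simp only [← this, momentFamily, hmon]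

/-- A transform that preserves moment families on the cube is a power series with nonnegative
coefficients. -/
theorem exists_hasSum_of_preserves {d : ℕ} (i : Fin d) {F : ℝ → ℝ}
    (hF : ∀ s ∈ momentSet (cube d), (fun α => F (s α)) ∈ momentSet (cube d)) :
    ∃ c : ℕ → ℝ, (∀ k, 0 ≤ c k) ∧ ∀ x : ℝ, HasSum (fun k => c k * x ^ k) (F x) := by
  have h2 : (1 / 2 : ℝ) ∈ Icc (-1 : ℝ) 1 := by constructor <;> norm_num
  have hF0 : ∀ x, 0 ≤ x → 0 ≤ F x := fun x hx => by
    simpa using (isIntervalMoment_two_atoms i hF hx le_rfl h2).zero_nonneg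
  -- With `u = 0` and `0 ^ 0 = 1`, the moments of orders `0` and `1` are `F y` and `F x`.
  have hFm : ∀ x y, 0 ≤ x → x ≤ y → F x ≤ F y := fun x y hx hxy => by
    simpa using (isIntervalMoment_two_atoms i hF hx (sub_nonneg.2 hxy)
      (u := 0) (by simp)).le_zero 1
  -- Mollification needs a globally monotone function, while `F` is so far controlled only on `[0,
  -- ∞)`. The value `F 0` is dropped here and recovered together with `x < 0`.
  set Φ : ℝ → ℝ := fun x => if 0 < x then F x else 0 with hΦ
  have hΦp : ∀ x, 0 < x → Φ x = F x := fun x hx => if_pos hx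
  have hmono : Monotone Φ := by
    intro x y hxy
    by_cases hx : 0 < x
    · rw [hΦp x hx, hΦp y (hx.trans_le hxy)]
      exact hFm x y hx.le hxy
    · have h0 : Φ x = 0 := if_neg hx
      rw [h0, hΦ]
      dsimp only
      split_ifs with hy
      · exact hF0 y hy.le
      · exact le_rfl
  obtain ⟨c, hc, hs⟩ := exists_hasSum_of_squeeze hmono fun ε hε => by
    obtain ⟨f, hf, hfd, hfb⟩ := exists_contDiff_between hmono (fun a ha b hb p hp => by
      have := (isIntervalMoment_two_atoms i hF ha.le hb.le h2).sum_nonneg hp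
      convert this using 3 with n
      exact hΦp _ (by positivity)) hε
    exact ⟨fun k => iteratedDeriv k f 0 / k !, f, fun k =>
      div_nonneg (hfd k 0 le_rfl) (by positivity), fun x hx =>
      ⟨hasSum_taylor_of_iteratedDeriv_nonneg hf hfd hx, hfb x⟩⟩
  have hsum : ∀ x : ℝ, Summable fun k => c k * x ^ k := by
    intro x
    refine (hs (|x| + 1) (by positivity)).summable.of_norm_bounded fun k => ?_
    rw [norm_mul, norm_pow, Real.norm_of_nonneg (hc k), Real.norm_eq_abs]
    exact mul_le_mul_of_nonneg_left (pow_le_pow_left₀ (abs_nonneg x) (by linarith) k) (hc k)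
  set G : ℝ → ℝ := fun x => ∑' k, c k * x ^ k with hG
  have hGs : ∀ x : ℝ, HasSum (fun k => c k * x ^ k) (G x) := fun x => (hsum x).hasSum
  have hpos : ∀ x, 0 < x → F x = G x := fun x hx => by
    rw [← hΦp x hx]
    exact (hs x hx).unique (hGs x)
  refine ⟨c, hc, fun x => ?_⟩
  have hFG : F x = G x := by
    rcases lt_or_ge 0 x with hx | hx
    · exact hpos x hx
    -- With `u = -1/2`, `a = 1 - x`, `b = 2 - 4 * x`, the number `a + b * u ^ n` is `x` at `n = 1`,
    -- `3 - 5 * x` at `n = 0`, and at least `a - b / 4 = 1 / 2` for `n ≥ 2`. So `F` and `G` agree at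
    -- every order except possibly the first.
    have hu : (-1 / 2 : ℝ) ∈ Icc (-1 : ℝ) 1 := by constructor <;> norm_num
    have ha : 0 ≤ 1 - x := by linarith
    have hb : 0 ≤ 2 - 4 * x := by linarith
    have hGp : ∀ s ∈ momentSet (cube d), (fun α => G (s α)) ∈ momentSet (cube d) := fun s hs =>
      comp_mem_momentSet_of_hasSum hc hGs hs
    have key := (isIntervalMoment_two_atoms i hF ha hb hu).one_eq
      (isIntervalMoment_two_atoms i hGp ha hb hu) fun n hn => hpos _ ?_
    · have h1 : 1 - x + (2 - 4 * x) * (-1 / 2) ^ 1 = x := by ring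
      simpa only [h1] using key
    · rcases n with _ | _ | n
      · simp only [pow_zero]
        linarith
      · exact absurd rfl hn
      · have h3 : |(-1 / 2 : ℝ) ^ (n + 1 + 1)| ≤ 1 / 4 := by
          rw [abs_pow, show |(-1 / 2 : ℝ)| = 1 / 2 by norm_num [abs_div], pow_succ, pow_succ]
          have : (1 / 2 : ℝ) ^ n ≤ 1 := pow_le_one₀ (by norm_num) (by norm_num)
          linarith
        have h4 := mul_le_mul_of_nonneg_left (abs_le.1 h3).1 hb
        linarith
  rw [hFG]
  exact hGs x

end MomentTransform

theorem theorem8p1 (d : ℕ) (hd : 1 ≤ d) (F : ℝ → ℝ) :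
    (∀ s ∈ MomentTransform.momentSet (MomentTransform.cube d),
        (fun α => F (s α)) ∈ MomentTransform.momentSet (MomentTransform.cube d)) ↔
      ∃ G : ℂ → ℂ, MomentTransform.AbsMonotonicEntire G ∧ ∀ x : ℝ, G (x : ℂ) = (F x : ℂ) := by
  constructor
  · intro h
    obtain ⟨c, hc, hs⟩ := MomentTransform.exists_hasSum_of_preserves ⟨0, hd⟩ h
    exact MomentTransform.exists_absMonotonicEntire hc hs
  · rintro ⟨G, hG, hGF⟩ s hs
    obtain ⟨c, hc, hsum⟩ := hG.exists_hasSum hGF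
    exact MomentTransform.comp_mem_momentSet_of_hasSum hc hsum hs
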